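/- **Definitions.** Fix a set of (ground) atoms. An objective literal is an atom $a$ or its explicit negation $\neg a$, with $\neg\neg L=L$; a default literal is $not\,L$ with $L$ an objective literal. An extended logic program $P$ is a possibly infinite set of rules $L_0\leftarrow L_1,\dots,L_m,not\,L_{m+1},\dots,not\,L_{m+n}$ with $m,n\ge 0$ and objective literals $L_i$. An *argument* is a finite sequence $A$ of rules of $P$ such that each objective literal in the body of a rule of $A$ is the head of a later rule of $A$. The heads of its rules are its *conclusions*, the default literals in the bodies of its rules its *assumptions*. $\mathit{Args}_P$ is the set of *minimal* arguments: those $A$ for which there is a conclusion $L$ of $A$ such that no proper subsequence of $A$ is an argument with conclusion $L$. For $A,B\in\mathit{Args}_P$: $A$ *undercuts* $B$ if some conclusion $L$ of $A$ has $not\,L$ among the assumptions of $B$; $A$ *rebuts* $B$ if $L$ is a conclusion of $A$ and $\neg L$ a conclusion of $B$ for some $L$; $A$ *attacks* $B$ if it undercuts or rebuts $B$. A *$u/a$-dialogue* is a finite nonempty sequence of moves (player, argument in $\mathit{Args}_P$) in which the proponent and the opponent alternate, the proponent starting; no player uses the same argument twice; every opponent move undercuts the preceding move; and every proponent move except the first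 attacks the preceding move. A player wins a dialogue if it is the other player's turn and that player cannot move. A *$u/a$-dialogue tree* is a rooted tree of moves without infinite branches, all of whose branches are $u/a$-dialogues, in which the children of a proponent move with argument $A$ are all the opponent moves $(O,B)$ such that $B$ undercuts $A$. It is won by the proponent if the proponent wins all its branches. An objective literal $L$ is a *provably $u/a$-justified conclusion* of $P$ if it is a conclusion of some $A\in\mathit{Args}_P$ that is the root of a $u/a$-dialogue tree won by the proponent. A *T-tree* (respectively *TU-tree*) for a literal $L$ is a possibly infinite tree with root labelled $L$ and nodes labelled by literals, such that: a node labelled with a default literal is a leaf; a node labelled with an objective literal $L'$ is a leaf if $P$ has no rule with head $L'$, and otherwise some rule of $P$ with head $L'$ is selected and the successors of the node are labelled with the literals of the body of that rule and, in a TU-tree, additionally with $not\,\neg L'$. Success and failure are determined inductively (as the least relations closed under these rules). Infinite trees are failed. A finite tree is successful if all its leaves are successful, and failed if some leaf is failed. A leaf labelled with an objective literal is failed if that literal has no rule, and successful otherwise (it has then been expanded by a rule with empty body). A leaf $not\,L'$ of a T-tree (respectively TU-tree) is successful if all TU-trees (respectively T-trees) for $L'$ are failed, and failed if some TU-tree (respectively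 T-tree) for $L'$ is successful. Finally, trees whose status is not determined by these rules are failed if they are T-trees and successful if they are TU-trees. **Corollary (T-trees).** Let $P$ be an extended logic program and $L$ an objective literal. Then $L$ is a provably $u/a$-justified conclusion of $P$ if and only if there is a successful T-tree for $L$. -/

import Mathlib

namespace ELP

/-! ### Extended logic programs -/

/-- Objective literals over a type `α` of (ground) atoms: `A` or its explicit negation `¬A`. -/
inductive ObjLit (α : Type*) where
  | pos (a : α) : ObjLit α
  | neg (a : α) : ObjLit α

/-- Explicit negation of an objective literal, with `¬¬L = L`. -/
def ObjLit.compl {α : Type*} : ObjLit α → ObjLit α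
  | .pos a => .neg a
  | .neg a => .pos a

/-- Literals: an objective literal `L` or a default literal `not L`. -/
inductive Literal (α : Type*) where
  | obj (L : ObjLit α) : Literal α
  | dflt (L : ObjLit α) : Literal α

/-- The rule `head ← posBody, not negBody`; both parts of the body are finite and may be empty. -/
structure Rule (α : Type*) where
  head : ObjLit α
  posBody : List (ObjLit α)
  negBody : List (ObjLit α)

/-- The list of all body literals of a rule. -/
def Rule.body {α : Type*} (r : Rule α) : List (Literal α) :=
  r.posBody.map Literal.obj ++ r.negBody.map Literal.dflt

/-- An extended logic program: a possibly infinite set of rules. -/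
abbrev Program (α : Type*) := Set (Rule α)

/-! ### Arguments -/

/-- A finite sequence of rules of `P` such that every objective literal in the body of a rule
is the head of some later rule of the sequence. -/
def IsArgument {α : Type*} (P : Program α) (A : List (Rule α)) : Prop :=
  (∀ r ∈ A, r ∈ P) ∧
    ∀ (i : ℕ) (hi : i < A.length), ∀ L ∈ A[i].posBody,
      ∃ (k : ℕ) (hk : k < A.length), i < k ∧ A[k].head = L

/-- `B` is a subargument of `A`: a subsequence of `A` that is an argument. -/
def IsSubargument {α : Type*} (P : Program α) (B A : List (Rule α)) : Prop :=
  B.Sublist A ∧ IsArgument P B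

/-- The conclusions of a sequence of rules: the heads of its rules. -/
def conc {α : Type*} (A : List (Rule α)) : Set (ObjLit α) :=
  {L | ∃ r ∈ A, r.head = L}

/-- The assumptions of a sequence of rules: the default literals in the bodies of its rules. -/
def assm {α : Type*} (A : List (Rule α)) : Set (Literal α) :=
  {l | ∃ r ∈ A, ∃ L ∈ r.negBody, l = Literal.dflt L}

/-- `A` is an argument with conclusion `L`, no proper subargument of which has conclusion `L`. -/
def IsMinimalFor {α : Type*} (P : Program α) (A : List (Rule α)) (L : ObjLit α) : Prop :=
  IsArgument P A ∧ L ∈ conc A ∧ ∀ B, IsSubargument P B A → L ∈ conc B → B = A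

/-- `Args P`: the minimal arguments of `P`, i.e. those that are minimal for some literal. -/
abbrev Args {α : Type*} (P : Program α) := {A : List (Rule α) // ∃ L, IsMinimalFor P A L}

/-! ### Attacks; `x A B` reads `(A, B) ∈ x` -/

/-- `A` undercuts `B`: some conclusion `L` of `A` is denied by an assumption `not L` of `B`. -/
def undercuts {α : Type*} (P : Program α) (A B : Args P) : Prop :=
  ∃ L, L ∈ conc A.1 ∧ Literal.dflt L ∈ assm B.1

/-- `A` rebuts `B`: some conclusion `L` of `A` is such that `¬L` is a conclusion of `B`. -/
def rebuts {α : Type*} (P : Program α) (A B : Args P) : Prop :=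
  ∃ L, L ∈ conc A.1 ∧ ObjLit.compl L ∈ conc B.1

/-- `A` attacks `B`: it undercuts or rebuts `B`. -/
def attacks {α : Type*} (P : Program α) (A B : Args P) : Prop :=
  undercuts P A B ∨ rebuts P A B

/-! ### Dialogues and dialogue trees -/

inductive Player where
  | proponent : Player
  | opponent : Player

def Player.other : Player → Player
  | .proponent => .opponent
  | .opponent => .proponent

abbrev Move {α : Type*} (P : Program α) := Player × Args P

/-- `x/y`-dialogues. Moves are numbered from `0` here, so the proponent makes the moves with an
even index. -/
structure IsDialogue {α : Type*} {P : Program α} (x y : Args P → Args P → Prop)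
    (d : List (Move P)) : Prop where
  nonempty : d ≠ []
  turns : ∀ (i : ℕ) (hi : i < d.length), d[i].1 = Player.proponent ↔ Even i
  no_repeat : ∀ (i j : ℕ) (hi : i < d.length) (hj : j < d.length),
    d[i].1 = d[j].1 → i ≠ j → d[i].2 ≠ d[j].2
  proponent_reply : ∀ (i : ℕ) (hi : i + 1 < d.length),
    d[i + 1].1 = Player.proponent → y d[i + 1].2 d[i].2
  opponent_reply : ∀ (i : ℕ) (hi : i + 1 < d.length),
    d[i + 1].1 = Player.opponent → x d[i + 1].2 d[i].2

/-- A player wins a dialogue iff it is the other player's turn and that player cannot move, that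
is, no move of the other player prolongs the dialogue. -/
def WinsDialogue {α : Type*} {P : Program α} (x y : Args P → Args P → Prop) (w : Player)
    (d : List (Move P)) : Prop :=
  (∃ A, d.getLast? = some (w, A)) ∧ ¬ ∃ B, IsDialogue x y (d ++ [(w.other, B)])

/-- An `x/y`-dialogue tree, given by its paths from the root: a node is identified with the
sequence of moves that leads from the root to it. All paths are dialogues, there is no infinite
path, and the children of a proponent's move with argument `A` are exactly the opponent's moves
with an argument that `x`-attacks `A`. -/
structure DialogueTree {α : Type*} {P : Program α} (x y : Args P → Args P → Prop) where
  root : Move P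
  paths : Set (List (Move P))
  root_mem : [root] ∈ paths
  starts_at_root : ∀ d ∈ paths, d.head? = some root
  prefix_closed : ∀ d ∈ paths, ∀ d', d' ≠ [] → d' <+: d → d' ∈ paths
  isDialogue : ∀ d ∈ paths, IsDialogue x y d
  no_infinite_path : ¬ ∃ f : ℕ → Move P, ∀ n : ℕ, (List.range (n + 1)).map f ∈ paths
  children : ∀ d ∈ paths, ∀ A : Args P, d.getLast? = some (Player.proponent, A) →
    ∀ m : Move P, d ++ [m] ∈ paths ↔ m.1 = Player.opponent ∧ x m.2 A

/-- A branch of a dialogue tree: a maximal path, from the root to a leaf. -/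
def DialogueTree.IsBranch {α : Type*} {P : Program α} {x y : Args P → Args P → Prop}
    (T : DialogueTree x y) (d : List (Move P)) : Prop :=
  d ∈ T.paths ∧ ∀ m, d ++ [m] ∉ T.paths

/-- A player wins a dialogue tree iff it wins all branches. -/
def DialogueTree.WonBy {α : Type*} {P : Program α} {x y : Args P → Args P → Prop}
    (T : DialogueTree x y) (w : Player) : Prop :=
  ∀ d, T.IsBranch d → WinsDialogue x y w d

/-- `A` is provably `x/y`-justified: it is the root of a dialogue tree won by the proponent. -/
def ProvablyJustified {α : Type*} {P : Program α} (x y : Args P → Args P → Prop)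
    (A : Args P) : Prop :=
  ∃ T : DialogueTree x y, T.root.2 = A ∧ T.WonBy Player.proponent

/-- `L` is a conclusion of a provably `x/y`-justified argument. -/
def ProvablyJustifiedConclusion {α : Type*} {P : Program α} (x y : Args P → Args P → Prop)
    (L : ObjLit α) : Prop :=
  ∃ A : Args P, L ∈ conc A.1 ∧ ProvablyJustified x y A

/-! ### T-trees and TU-trees of the proof procedure for WFSX -/

/-- T-trees establish truth, TU-trees establish non-falsity (true or undefined). -/
inductive TreeKind where
  | T : TreeKind
  | TU : TreeKind

def TreeKind.other : TreeKind → TreeKind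
  | .T => .TU
  | .TU => .T

/-- Labels of the successors of a node that is expanded by the rule `r`: the body of `r`, and in
a TU-tree additionally `not ¬head`. -/
def successors {α : Type*} (k : TreeKind) (r : Rule α) : List (Literal α) :=
  match k with
  | .T => r.body
  | .TU => Literal.dflt r.head.compl :: r.body

/-- A finitely branching, possibly infinite tree labelled with literals. The node reached from
the root by going to child number `i₁`, then to child number `i₂`, and so on, is the list
`[i₁, i₂, …]`; the label `none` means that there is no such node. -/
abbrev LTree (α : Type*) := List ℕ → Option (Literal α)

/-- `t` is a T-tree (TU-tree) for the literal `l`: an AND-tree with root `l`, built by expanding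
each node labelled with an objective literal by one rule for it (if there is no rule, the node is
a leaf), while nodes labelled with default literals are leaves. -/
structure IsTreeFor {α : Type*} (P : Program α) (k : TreeKind) (l : Literal α)
    (t : LTree α) : Prop where
  root : t [] = some l
  no_orphan : ∀ p, t p = none → ∀ i, t (p ++ [i]) = none
  default_leaf : ∀ p L, t p = some (Literal.dflt L) → ∀ i, t (p ++ [i]) = none
  objective_node : ∀ p L, t p = some (Literal.obj L) →
    ((∀ r ∈ P, r.head ≠ L) ∧ ∀ i, t (p ++ [i]) = none) ∨
    ∃ r ∈ P, r.head = L ∧ ∀ i : ℕ, t (p ++ [i]) = (successors k r)[i]?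

/-- `t` has finitely many nodes. -/
def LTree.IsFinite {α : Type*} (t : LTree α) : Prop := {p | t p ≠ none}.Finite

/-- `p` is a leaf of `t` with label `l`. -/
def LTree.IsLeaf {α : Type*} (t : LTree α) (p : List ℕ) (l : Literal α) : Prop :=
  t p = some l ∧ ∀ i, t (p ++ [i]) = none

universe u

mutual

/-- A finite tree all of whose leaves are successful is successful. -/
inductive DeterminedSuccessful {α : Type u} (P : Program α) : TreeKind → LTree α → Prop
  | intro (k : TreeKind) (t : LTree α) (hfin : t.IsFinite)
      (hleaf : ∀ p l, t.IsLeaf p l → LeafSuccessful P k l) : DeterminedSuccessful P k t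

/-- Infinite trees are failed, and so are trees with a failed leaf. -/
inductive DeterminedFailed {α : Type u} (P : Program α) : TreeKind → LTree α → Prop
  | infinite (k : TreeKind) (t : LTree α) (hinf : ¬ t.IsFinite) : DeterminedFailed P k t
  | leaf (k : TreeKind) (t : LTree α) (p : List ℕ) (l : Literal α) (hl : t.IsLeaf p l)
      (hfail : LeafFailed P k l) : DeterminedFailed P k t

/-- A leaf labelled with an objective literal that has a rule (it was expanded by a rule with
empty body) is successful. A leaf `not L` of a T-tree (TU-tree) is successful if all TU-trees
(T-trees) for `L` are failed. -/
inductive LeafSuccessful {α : Type u} (P : Program α) : TreeKind → Literal α → Prop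
  | fact (k : TreeKind) (L : ObjLit α) (h : ∃ r ∈ P, r.head = L) :
      LeafSuccessful P k (Literal.obj L)
  | allFailed (k : TreeKind) (L : ObjLit α)
      (h : ∀ t, IsTreeFor P k.other (Literal.obj L) t → DeterminedFailed P k.other t) :
      LeafSuccessful P k (Literal.dflt L)

/-- A leaf labelled with an objective literal without rules is failed. A leaf `not L` of a T-tree
(TU-tree) is failed if there is a successful TU-tree (T-tree) for `L`. -/
inductive LeafFailed {α : Type u} (P : Program α) : TreeKind → Literal α → Prop
  | noRule (k : TreeKind) (L : ObjLit α) (h : ∀ r ∈ P, r.head ≠ L) :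
      LeafFailed P k (Literal.obj L)
  | someSuccessful (k : TreeKind) (L : ObjLit α) (t : LTree α)
      (ht : IsTreeFor P k.other (Literal.obj L) t)
      (hs : DeterminedSuccessful P k.other t) : LeafFailed P k (Literal.dflt L)

end

/-- The final status of a tree: a tree that the rules above leave undetermined is failed if it is
a T-tree and successful if it is a TU-tree. -/
def IsSuccessful {α : Type*} (P : Program α) (k : TreeKind) (t : LTree α) : Prop :=
  match k with
  | .T => DeterminedSuccessful P .T t
  | .TU => ¬ DeterminedFailed P .TU t

end ELP

namespace ELP

universe u

-- Both sides describe the conclusions of the least set of arguments closed under one rule: `A`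
-- belongs once every undercutter of `A` is attacked by a member. `Winning` is this set, with an
-- ordinal rank for each member.
--
-- On the dialogue side, a won tree is well-founded and so yields induction along the rule
-- (`ProvablyJustified.induction`). Conversely, a proponent who only gives replies of smaller rank
-- makes ranks fall along every play, so no move recurs and no play is infinite
-- (`Winning.provablyJustified`).
--
-- On the tree side, the rules of an argument assemble into finite trees for its conclusions
-- (`IsArgument.exists_tree`), and the rules of a finite fully expanded tree, listed by depth, form
-- an argument (`IsTreeFor.exists_argument`). Default leaves of T-trees are assumptions, hence
-- targets of undercuts. The extra leaves `not ¬L` of TU-trees add the targets of rebuttals. Thus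
-- success of T-trees and failure of TU-trees obey the same recursion as the game.

theorem Player.other_eq_proponent {p : Player} : p.other = .proponent ↔ p = .opponent := by
  cases p <;> simp [Player.other]

theorem Player.other_eq_opponent {p : Player} : p.other = .opponent ↔ p = .proponent := by
  cases p <;> simp [Player.other]

/-! ### Winning moves and dialogue trees -/

section Game

variable {α : Type u} {P : Program α} {x y : Args P → Args P → Prop}

/-- The proponent can force a win from the given move, with game ranks bounded by an ordinal. -/
inductive WinsWithin (x y : Args P → Args P → Prop) : Ordinal.{u} → Move P → Prop
  | proponent (o : Ordinal.{u}) (A : Args P) (f : Args P → Ordinal.{u})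
      (hf : ∀ B, x B A → f B < o)
      (h : ∀ B, x B A → WinsWithin x y (f B) (Player.opponent, B)) :
      WinsWithin x y o (Player.proponent, A)
  | opponent (o o' : Ordinal.{u}) (B C : Args P) (hy : y C B) (ho : o' < o)
      (h : WinsWithin x y o' (Player.proponent, C)) : WinsWithin x y o (Player.opponent, B)

/-- The proponent can force a win from the given move. -/
def Winning (x y : Args P → Args P → Prop) (m : Move P) : Prop := ∃ o, WinsWithin x y o m

/-- The least ordinal bound on the game from the given move. -/
noncomputable def rank (x y : Args P → Args P → Prop) (m : Move P) : Ordinal.{u} :=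
  sInf {o | WinsWithin x y o m}

theorem Winning.winsWithin_rank {m : Move P} (h : Winning x y m) :
    WinsWithin x y (rank x y m) m :=
  csInf_mem (s := {o | WinsWithin x y o m}) h

theorem WinsWithin.rank_le {o : Ordinal.{u}} {m : Move P} (h : WinsWithin x y o m) :
    rank x y m ≤ o :=
  csInf_le' h

theorem Winning.of_undercutter {A B : Args P} (h : Winning x y (Player.proponent, A))
    (hB : x B A) : Winning x y (Player.opponent, B) ∧
      rank x y (Player.opponent, B) < rank x y (Player.proponent, A) := by
  have h' := h.winsWithin_rank
  generalize hr : rank x y (Player.proponent, A) = o at h'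
  cases h' with
  | proponent _ _ f hf h => exact ⟨⟨_, h B hB⟩, (h B hB).rank_le.trans_lt (hf B hB)⟩

theorem Winning.exists_reply {B : Args P} (h : Winning x y (Player.opponent, B)) :
    ∃ C, y C B ∧ Winning x y (Player.proponent, C) ∧
      rank x y (Player.proponent, C) < rank x y (Player.opponent, B) := by
  have h' := h.winsWithin_rank
  generalize hr : rank x y (Player.opponent, B) = o at h'
  cases h' with
  | opponent _ o' _ C hy ho h => exact ⟨C, hy, ⟨_, h⟩, h.rank_le.trans_lt ho⟩

/-- The ranks of the replies are indexed by `Args P`, a type in universe `u`, so they have a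
supremum in `Ordinal.{u}`. -/
theorem winning_of_forall_exists {A : Args P}
    (h : ∀ B, x B A → ∃ C, y C B ∧ Winning x y (Player.proponent, C)) :
    Winning x y (Player.proponent, A) := by
  have h' : ∀ B, ∃ o : Ordinal.{u}, x B A → WinsWithin x y o (Player.opponent, B) := by
    intro B
    by_cases hB : x B A
    · obtain ⟨C, hC, o, ho⟩ := h B hB
      exact ⟨Order.succ o, fun _ => .opponent _ o B C hC (Order.lt_succ o) ho⟩
    -- Arbitrary value: only the ordinals at attackers of `A` matter.
    · exact ⟨0, fun h => absurd h hB⟩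
  choose f hf using h'
  refine ⟨Order.succ (⨆ B, f B), .proponent _ A f (fun B _ => ?_) hf⟩
  exact Order.lt_succ_of_le (Ordinal.le_iSup f B)

-- From winning arguments to dialogue trees

/-- The legal replies to a move that decrease the rank. -/
def RankedReply (x y : Args P → Args P → Prop) (m m' : Move P) : Prop :=
  rank x y m' < rank x y m ∧ m'.1 = m.1.other ∧
    (m.1 = Player.proponent → x m'.2 m.2) ∧ (m.1 = Player.opponent → y m'.2 m.2)

/-- The plays from `(P, A)` in which every move is winning and every reply decreases the rank. -/
def rankedPlays (x y : Args P → Args P → Prop) (A : Args P) : Set (List (Move P)) :=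
  {d | d.head? = some (Player.proponent, A) ∧ d.IsChain (RankedReply x y) ∧
    ∀ m ∈ d, Winning x y m}

theorem isDialogue_of_mem_rankedPlays {A : Args P} {d : List (Move P)}
    (hd : d ∈ rankedPlays x y A) : IsDialogue x y d := by
  obtain ⟨hhead, hchain, -⟩ := hd
  have hstep := List.isChain_iff_getElem.1 hchain
  have hturns : ∀ (i : ℕ) (hi : i < d.length), d[i].1 = Player.proponent ↔ Even i := by
    intro i
    induction i with
    | zero =>
      intro hi
      have : d[0] = (Player.proponent, A) := by
        cases d with
        | nil => simp at hhead
        | cons a l => simpa using hhead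
      simp [this]
    | succ n ih =>
      intro hi
      have h1 := (hstep n hi).2.1
      have h2 := ih (by omega)
      rw [h1, Nat.even_add_one, ← h2]
      cases d[n].1 <;> simp [Player.other]
  have hpair : d.Pairwise fun m m' => rank x y m' < rank x y m :=
    have : IsTrans (Move P) fun m m' => rank x y m' < rank x y m :=
      ⟨fun _ _ _ h h' => h'.trans h⟩
    List.isChain_iff_pairwise.1 (hchain.imp fun _ _ h => h.1)
  -- Strictly falling ranks forbid repeated moves, which is the no-repetition rule for both players
  -- at once.
  have hnodup : d.Nodup := hpair.imp fun {m m'} h e => by simp [e] at h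
  refine ⟨by rintro rfl; simp at hhead, hturns, ?_, ?_, ?_⟩
  · intro i j hi hj h1 hij h2
    exact hij ((hnodup.getElem_inj_iff).1 (Prod.ext h1 h2))
  · intro i hi h
    refine (hstep i hi).2.2.2 ?_
    have h1 := (hstep i hi).2.1
    rw [h] at h1
    exact Player.other_eq_proponent.1 h1.symm
  · intro i hi h
    refine (hstep i hi).2.2.1 ?_
    have h1 := (hstep i hi).2.1
    rw [h] at h1
    exact Player.other_eq_opponent.1 h1.symm

theorem append_mem_rankedPlays {A : Args P} {d : List (Move P)} {m m' : Move P}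
    (hd : d ∈ rankedPlays x y A) (hm : d.getLast? = some m) (hr : RankedReply x y m m')
    (hw : Winning x y m') : d ++ [m'] ∈ rankedPlays x y A := by
  obtain ⟨hhead, hchain, hwin⟩ := hd
  refine ⟨by simp [hhead], ?_, ?_⟩
  · rw [List.isChain_append]
    refine ⟨hchain, by simp, ?_⟩
    intro a ha b hb
    simp only [hm, Option.mem_def, Option.some.injEq, List.head?_cons] at ha hb
    exact ha ▸ hb ▸ hr
  · intro n hn
    rcases List.mem_append.1 hn with hn | hn
    · exact hwin n hn
    · simp only [List.mem_singleton] at hn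
      exact hn ▸ hw

theorem opponent_append_mem_rankedPlays {A A' B : Args P} {d : List (Move P)}
    (hd : d ∈ rankedPlays x y A) (hm : d.getLast? = some (Player.proponent, A'))
    (hB : x B A') : d ++ [(Player.opponent, B)] ∈ rankedPlays x y A := by
  have h := (hd.2.2 _ (List.mem_of_getLast? hm)).of_undercutter hB
  exact append_mem_rankedPlays hd hm
    ⟨h.2, rfl, fun _ => hB, fun h => by cases h⟩ h.1

/-- The dialogue tree of all ranked plays from a winning argument. -/
noncomputable def rankedTree {A : Args P} (hA : Winning x y (Player.proponent, A)) :
    DialogueTree x y where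
  root := (Player.proponent, A)
  paths := rankedPlays x y A
  root_mem := ⟨rfl, by simp, by simpa using hA⟩
  starts_at_root := fun _ hd => hd.1
  prefix_closed := by
    rintro d ⟨hhead, hchain, hwin⟩ d' hne hpre
    refine ⟨?_, hchain.prefix hpre, fun m hm => hwin m (hpre.subset hm)⟩
    obtain ⟨s, rfl⟩ := hpre
    cases d' with
    | nil => exact absurd rfl hne
    | cons a l => simpa using hhead
  isDialogue := fun _ hd => isDialogue_of_mem_rankedPlays hd
  no_infinite_path := by
    rintro ⟨f, hf⟩
    refine not_strictAnti_of_wellFoundedLT (fun n => rank x y (f n))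
      (strictAnti_nat_of_succ_lt fun n => ?_)
    have := (List.isChain_iff_getElem.1 (hf (n + 1)).2.1 n (by simp)).1
    simpa using this
  children := by
    intro d hd A' hlast m
    constructor
    · intro h
      have h1 := (List.isChain_append.1 h.2.1).2.2 _ hlast m rfl
      exact ⟨h1.2.1, h1.2.2.1 rfl⟩
    · rcases m with ⟨p, B⟩
      rintro ⟨hp : p = _, hB⟩
      subst hp
      exact opponent_append_mem_rankedPlays hd hlast hB

/-- A maximal ranked play cannot end with the opponent, since a winning opponent move has a reply of
smaller rank. After a proponent move, any legal opponent move would be a child and contradict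
maximality. -/
theorem Winning.provablyJustified {A : Args P} (hA : Winning x y (Player.proponent, A)) :
    ProvablyJustified x y A := by
  refine ⟨rankedTree hA, rfl, ?_⟩
  rintro d ⟨hd, hmax⟩
  replace hd : d ∈ rankedPlays x y A := hd
  replace hmax : ∀ m, d ++ [m] ∉ rankedPlays x y A := hmax
  have hne := (isDialogue_of_mem_rankedPlays hd).nonempty
  obtain ⟨⟨p, A'⟩, hm⟩ : ∃ m, d.getLast? = some m := ⟨_, List.getLast?_eq_some_getLast hne⟩
  cases p with
  | proponent =>
    refine ⟨⟨A', hm⟩, ?_⟩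
    rintro ⟨B, hB⟩
    refine hmax (Player.opponent, B) (opponent_append_mem_rankedPlays hd hm ?_)
    obtain ⟨l, rfl⟩ := List.getLast?_eq_some_iff.1 hm
    simpa [Player.other] using hB.opponent_reply l.length (by simp) (by simp [Player.other])
  | opponent =>
    obtain ⟨C, hC, hw, hr⟩ := (hd.2.2 _ (List.mem_of_getLast? hm)).exists_reply
    exact absurd (append_mem_rankedPlays (m' := (Player.proponent, C)) hd hm
      ⟨hr, rfl, (fun h => by cases h), fun _ => hC⟩ hw) (hmax _)

-- Induction along won dialogue trees

/-- Extension of paths of a dialogue tree by one move. -/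
def DialogueTree.Extends (T : DialogueTree x y) (d' d : List (Move P)) : Prop :=
  d' ∈ T.paths ∧ ∃ m, d' = d ++ [m]

theorem DialogueTree.acc_root (T : DialogueTree x y) : Acc T.Extends [T.root] := by
  by_contra h
  obtain ⟨g, h0, hg⟩ := not_acc_iff_exists_descending_chain.1 h
  choose hmem m hm using hg
  -- `m k` is the move appended at step `k`, so the infinite path is the root followed by `m 0`, `m
  -- 1`, and so on.
  refine T.no_infinite_path ⟨fun n => Nat.casesOn n T.root m, fun n => ?_⟩
  have key : ∀ n : ℕ, (List.range (n + 1)).map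
      (fun n => (Nat.casesOn n T.root m : Move P)) = g n := by
    intro n
    induction n with
    | zero => simp [h0]
    | succ k ih => rw [List.range_succ, List.map_append, ih, hm]; rfl
  rw [key]
  cases n with
  | zero => rw [h0]; exact T.root_mem
  | succ k => exact hmem k

/-- Well-founded induction on paths. All undercutters of a proponent move occur as its children, and
every opponent node has a child because a branch stopping there is not won by the proponent. -/
theorem ProvablyJustified.induction {A : Args P} (hA : ProvablyJustified x y A)
    {Q : Args P → Prop} (hQ : ∀ A, (∀ B, x B A → ∃ C, y C B ∧ Q C) → Q A) : Q A := by
  obtain ⟨T, rfl, hwon⟩ := hA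
  have key : ∀ d, Acc T.Extends d → d ∈ T.paths →
      (∀ A, d.getLast? = some (Player.proponent, A) → Q A) ∧
      ∀ B, d.getLast? = some (Player.opponent, B) → ∃ C, y C B ∧ Q C := by
    intro d hacc
    induction hacc with
    | intro d _ ih =>
      intro hd
      constructor
      · intro A hA
        refine hQ A fun B hB => ?_
        have hd' := (T.children d hd A hA (Player.opponent, B)).2 ⟨rfl, hB⟩
        exact (ih _ ⟨hd', _, rfl⟩ hd').2 B (by simp)
      · intro B hB
        have hnb : ¬ T.IsBranch d := by
          intro hb
          obtain ⟨⟨A, hA⟩, -⟩ := hwon d hb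
          rw [hB] at hA
          cases hA
        obtain ⟨⟨p, C⟩, hC⟩ : ∃ m, d ++ [m] ∈ T.paths := by
          by_contra h
          exact hnb ⟨hd, fun m hm => h ⟨m, hm⟩⟩
        obtain ⟨l, rfl⟩ := List.getLast?_eq_some_iff.1 hB
        have hdia := T.isDialogue _ hC
        have h1 := hdia.turns l.length (by simp)
        have h2 := hdia.turns (l.length + 1) (by simp)
        have hp : p = Player.proponent := by
          simp [Nat.even_add_one] at h1 h2
          exact h2.2 h1
        subst hp
        have h3 := hdia.proponent_reply l.length (by simp) (by simp)
        exact ⟨C, by simpa using h3, (ih _ ⟨hC, _, rfl⟩ hC).1 C (by simp)⟩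
  have hroot : T.root.1 = Player.proponent := by
    simpa using (T.isDialogue _ T.root_mem).turns 0 (by simp)
  exact (key _ T.acc_root T.root_mem).1 _ (by simp [← hroot])

end Game

/-! ### Arguments and trees -/

section Trees

variable {α : Type u} {P : Program α}

theorem ObjLit.compl_compl (L : ObjLit α) : L.compl.compl = L := by cases L <;> rfl

-- Minimal arguments and their labels

theorem IsArgument.exists_minimal {A : List (Rule α)} (hA : IsArgument P A) {L : ObjLit α}
    (hL : L ∈ conc A) : ∃ B, B.Sublist A ∧ IsMinimalFor P B L := by
  induction h : A.length using Nat.strong_induction_on generalizing A with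
  | _ n ih =>
    by_cases hmin : IsMinimalFor P A L
    · exact ⟨A, .refl A, hmin⟩
    · have : ∃ B, IsSubargument P B A ∧ L ∈ conc B ∧ B ≠ A := by
        by_contra! hc
        exact hmin ⟨hA, hL, hc⟩
      obtain ⟨B, ⟨hs, hB⟩, hLB, hne⟩ := this
      have hlt : B.length < n :=
        h ▸ lt_of_le_of_ne hs.length_le fun e => hne (hs.eq_of_length e)
      obtain ⟨C, hC, hCm⟩ := ih _ hlt hB hLB rfl
      exact ⟨C, hC.trans hs, hCm⟩

theorem IsArgument.tail {r : Rule α} {A : List (Rule α)} (h : IsArgument P (r :: A)) :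
    IsArgument P A := by
  refine ⟨fun s hs => h.1 s (List.mem_cons_of_mem _ hs), fun i hi L hL => ?_⟩
  obtain ⟨k, hk, hik, hkL⟩ := h.2 (i + 1) (by simpa using hi) L (by simpa using hL)
  obtain ⟨k, rfl⟩ : ∃ k', k = k' + 1 := ⟨k - 1, by omega⟩
  exact ⟨k, by simpa using hk, by omega, by simpa using hkL⟩

theorem IsArgument.posBody_subset {r : Rule α} {A : List (Rule α)}
    (h : IsArgument P (r :: A)) {L : ObjLit α} (hL : L ∈ r.posBody) : L ∈ conc A := by
  obtain ⟨k, hk, hik, hkL⟩ := h.2 0 (by simp) L (by simpa using hL)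
  obtain ⟨k, rfl⟩ : ∃ k', k = k' + 1 := ⟨k - 1, by omega⟩
  exact ⟨_, List.getElem_mem (by simpa using hk), by simpa using hkL⟩

theorem mem_successors {k : TreeKind} {r : Rule α} {l : Literal α} :
    l ∈ successors k r ↔ (∃ L ∈ r.posBody, l = .obj L) ∨ (∃ L ∈ r.negBody, l = .dflt L) ∨
      (k = .TU ∧ l = .dflt r.head.compl) := by
  cases k
  · simp [successors, Rule.body, eq_comm]
  · simp only [successors, Rule.body, List.mem_cons, List.mem_append, List.mem_map, true_and,
      eq_comm (b := l)]
    exact (or_comm.trans or_assoc)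

/-- The literals that label a tree of kind `k` built from the rules in `A`. -/
def treeLabels (k : TreeKind) (A : List (Rule α)) : Set (Literal α) :=
  {l | (∃ L ∈ conc A, l = .obj L) ∨ ∃ r ∈ A, ∃ L, l = .dflt L ∧ l ∈ successors k r}

theorem treeLabels_subset_cons (k : TreeKind) (r : Rule α) (A : List (Rule α)) :
    treeLabels k A ⊆ treeLabels k (r :: A) := by
  rintro l (⟨L, ⟨s, hs, hsL⟩, hl⟩ | ⟨s, hs, h⟩)
  · exact .inl ⟨L, ⟨s, List.mem_cons_of_mem _ hs, hsL⟩, hl⟩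
  · exact .inr ⟨s, List.mem_cons_of_mem _ hs, h⟩

-- Building trees from arguments

/-- The tree with root `l` and the subtree `f l'` at each child `l'` in `ls`. -/
def LTree.node (l : Literal α) (ls : List (Literal α)) (f : Literal α → LTree α) : LTree α
  | [] => some l
  | i :: p => ls[i]?.bind fun l' => f l' p

theorem LTree.node_cons_cases (l : Literal α) (ls : List (Literal α)) (f : Literal α → LTree α)
    (i : ℕ) : (∃ l' ∈ ls, ∀ p, LTree.node l ls f (i :: p) = f l' p) ∨
      ∀ p, LTree.node l ls f (i :: p) = none := by
  by_cases hi : i < ls.length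
  · exact .inl ⟨_, List.getElem_mem hi, fun q => by simp [LTree.node, hi]⟩
  · exact .inr fun q => by simp [LTree.node, List.getElem?_eq_none (not_lt.1 hi)]

theorem LTree.node_isFinite (l : Literal α) (ls : List (Literal α)) (f : Literal α → LTree α)
    (hf : ∀ l' ∈ ls, (f l').IsFinite) : (LTree.node l ls f).IsFinite := by
  have : {p | LTree.node l ls f p ≠ none} ⊆ {[]} ∪
      ⋃ i : Fin ls.length, (fun p => (i : ℕ) :: p) '' {p | f ls[i] p ≠ none} := by
    rintro (_ | ⟨i, p⟩) hp
    · simp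
    · right
      replace hp : ls[i]?.bind (fun l' => f l' p) ≠ none := hp
      by_cases hi : i < ls.length
      · refine Set.mem_iUnion.2 ⟨⟨i, hi⟩, p, ?_, rfl⟩
        simpa [hi] using hp
      · simp [List.getElem?_eq_none (not_lt.1 hi)] at hp
  refine Set.Finite.subset ((Set.finite_singleton _).union
    (Set.finite_iUnion fun i => Set.Finite.image _ ?_)) this
  exact hf _ (List.getElem_mem _)

theorem LTree.node_isTreeFor {k : TreeKind} {r : Rule α} (hr : r ∈ P)
    {f : Literal α → LTree α} (hf : ∀ l ∈ successors k r, IsTreeFor P k l (f l)) :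
    IsTreeFor P k (.obj r.head) (LTree.node (.obj r.head) (successors k r) f) := by
  have hsub := LTree.node_cons_cases (.obj r.head) (successors k r) f
  refine ⟨rfl, ?_, ?_, ?_⟩
  · rintro (_ | ⟨i, p⟩) hp j
    · cases hp
    · rcases hsub i with ⟨l, hl, h⟩ | h
      · rw [List.cons_append, h]
        exact (hf l hl).no_orphan p (h p ▸ hp) j
      · exact h _
  · rintro (_ | ⟨i, p⟩) L hp j
    · cases hp
    · rcases hsub i with ⟨l, hl, h⟩ | h
      · rw [List.cons_append, h]
        exact (hf l hl).default_leaf p L (h p ▸ hp) j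
      · exact h _
  · rintro (_ | ⟨i, p⟩) L hp
    · cases hp
      refine .inr ⟨r, hr, rfl, fun i => ?_⟩
      by_cases hi : i < (successors k r).length
      · simpa [LTree.node, hi] using (hf _ (List.getElem_mem hi)).root
      · simp [LTree.node, List.getElem?_eq_none (not_lt.1 hi)]
    · rcases hsub i with ⟨l, hl, h⟩ | h
      · simp only [List.cons_append, h] at hp ⊢
        exact (hf l hl).objective_node p L hp
      · rw [h] at hp
        cases hp

theorem LTree.node_dflt_isTreeFor (k : TreeKind) (L : ObjLit α) (f : Literal α → LTree α) :
    IsTreeFor P k (.dflt L) (LTree.node (.dflt L) [] f) := by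
  refine ⟨rfl, ?_, ?_, ?_⟩
  · rintro (_ | ⟨i, p⟩) _ _ <;> rfl
  · rintro (_ | ⟨i, p⟩) _ _ _ <;> rfl
  · rintro (_ | ⟨i, p⟩) _ hp <;> cases hp

/-- From the rules of an argument one can build finite trees for its conclusions. -/
theorem IsArgument.exists_tree (k : TreeKind) {A : List (Rule α)} (hA : IsArgument P A)
    {l : Literal α} (hl : l ∈ treeLabels k A) : ∃ t, IsTreeFor P k l t ∧ t.IsFinite ∧
      ∀ p l', t p = some l' → l' ∈ treeLabels k A := by
  rcases l with L | L
  swap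
  · refine ⟨_, LTree.node_dflt_isTreeFor k L fun _ _ => none,
      LTree.node_isFinite _ _ _ (by simp), ?_⟩
    rintro (_ | ⟨i, p⟩) l' hp <;> cases hp
    exact hl
  induction A generalizing L with
  | nil => simp [treeLabels, conc] at hl
  | cons r A ih =>
    -- A conclusion of the tail keeps its tree from there. Otherwise the first rule expands the
    -- root, and its objective body literals are conclusions of the tail.
    by_cases hLA : Literal.obj L ∈ treeLabels k A
    · obtain ⟨t, ht, hfin, hlab⟩ := ih hA.tail L hLA
      exact ⟨t, ht, hfin, fun p l' hp => treeLabels_subset_cons k r A (hlab p l' hp)⟩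
    · have hLr : r.head = L := by
        rcases hl with ⟨L', ⟨s, hs, rfl⟩, hL'⟩ | ⟨s, hs, L', hL', -⟩
        · cases hL'
          rcases List.mem_cons.1 hs with rfl | hs
          · rfl
          · exact absurd (.inl ⟨_, ⟨s, hs, rfl⟩, rfl⟩) hLA
        · cases hL'
      subst hLr
      have hsub : ∀ l : Literal α, ∃ t, l ∈ successors k r → IsTreeFor P k l t ∧
          t.IsFinite ∧ ∀ p l', t p = some l' → l' ∈ treeLabels k (r :: A) := by
        intro l
        by_cases hl : l ∈ successors k r
        swap
        · exact ⟨fun _ => none, fun h => absurd h hl⟩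
        rcases l with L | L
        · have hL : L ∈ r.posBody := by
            rcases mem_successors.1 hl with ⟨L', h, e⟩ | ⟨L', h, e⟩ | ⟨-, e⟩ <;> cases e
            exact h
          obtain ⟨t, ht, hfin, hlab⟩ := ih hA.tail L (.inl ⟨L, hA.posBody_subset hL, rfl⟩)
          exact ⟨t, fun _ =>
            ⟨ht, hfin, fun p l' hp => treeLabels_subset_cons k r A (hlab p l' hp)⟩⟩
        · refine ⟨_, fun _ => ⟨LTree.node_dflt_isTreeFor k L fun _ _ => none,
            LTree.node_isFinite _ _ _ (by simp), ?_⟩⟩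
          rintro (_ | ⟨i, p⟩) l' hp <;> cases hp
          exact .inr ⟨r, by simp, L, rfl, hl⟩
      choose f hf using hsub
      refine ⟨_, LTree.node_isTreeFor (hA.1 r (by simp)) fun l hl => (hf l hl).1,
        LTree.node_isFinite _ _ _ fun l hl => (hf l hl).2.1, ?_⟩
      rintro (_ | ⟨i, p⟩) l' hp
      · cases hp
        exact hl
      · rcases LTree.node_cons_cases (.obj r.head) (successors k r) f i with ⟨l, hl, h⟩ | h
        · exact (hf l hl).2.2 p l' (h p ▸ hp)
        · rw [h] at hp
          cases hp

-- Extracting arguments from trees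

/-- The rules used in a finite fully expanded tree form an argument. -/
theorem IsTreeFor.exists_argument {k : TreeKind} {L : ObjLit α} {t : LTree α}
    (ht : IsTreeFor P k (.obj L) t) (hfin : t.IsFinite)
    (hexp : ∀ p L', t p = some (.obj L') → ∃ r ∈ P, r.head = L') :
    ∃ A, IsArgument P A ∧ L ∈ conc A ∧
      ∀ r ∈ A, ∀ L', .dflt L' ∈ successors k r → ∃ p, t.IsLeaf p (.dflt L') := by
  have hrule : ∀ p, ∃ r : Rule α, (∃ L', t p = some (.obj L')) →
      r ∈ P ∧ t p = some (.obj r.head) ∧ ∀ i : ℕ, t (p ++ [i]) = (successors k r)[i]? := by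
    intro p
    by_cases h : ∃ L', t p = some (.obj L')
    · obtain ⟨L', hL'⟩ := h
      rcases ht.objective_node p L' hL' with ⟨hno, -⟩ | ⟨r, hr, rfl, hs⟩
      · obtain ⟨r, hr, hrL⟩ := hexp p L' hL'
        exact absurd hrL (hno r hr)
      · exact ⟨r, fun _ => ⟨hr, hL', hs⟩⟩
    · exact ⟨⟨L, [], []⟩, fun h' => absurd h' h⟩
  choose rule hrule using hrule
  have hS : {p | ∃ L', t p = some (.obj L')}.Finite :=
    hfin.subset fun p ⟨L', hL'⟩ => by simp [hL']
  -- Positions are sorted by depth. A child is strictly deeper than its parent, so its rule comes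
  -- later in the list, however ties are broken.
  let le : List ℕ → List ℕ → Prop := fun p q => p.length ≤ q.length
  have : Std.Total le := ⟨fun p q => le_total p.length q.length⟩
  have : IsTrans _ le := ⟨fun _ _ _ h h' => Nat.le_trans h h'⟩
  let N := hS.toFinset.toList.insertionSort le
  have hN : ∀ p, p ∈ N ↔ ∃ L', t p = some (.obj L') := by
    intro p
    simp [N, List.mem_insertionSort]
  have hsorted : N.Pairwise le := List.pairwise_insertionSort le _
  have hchild : ∀ p ∈ N, ∀ l ∈ successors k (rule p), ∃ i : ℕ, t (p ++ [i]) = some l := by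
    intro p hp l hl
    obtain ⟨i, hi⟩ := List.mem_iff_getElem?.1 hl
    exact ⟨i, ((hrule p ((hN p).1 hp)).2.2 i).trans hi⟩
  refine ⟨N.map rule, ⟨?_, ?_⟩, ?_, ?_⟩
  · intro r hr
    obtain ⟨p, hp, rfl⟩ := List.mem_map.1 hr
    exact (hrule p ((hN p).1 hp)).1
  · intro i hi L' hL'
    rw [List.length_map] at hi
    simp only [List.getElem_map] at hL'
    obtain ⟨j, hj⟩ := hchild N[i] (List.getElem_mem hi) (.obj L')
      (mem_successors.2 (.inl ⟨L', hL', rfl⟩))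
    obtain ⟨m, hm, hmj⟩ := List.mem_iff_getElem.1 ((hN _).2 ⟨L', hj⟩)
    refine ⟨m, by simpa using hm, ?_, ?_⟩
    · by_contra hle
      have h1 : N[m].length = N[i].length + 1 := by simp [hmj]
      rcases (not_lt.1 hle).eq_or_lt with rfl | hlt
      · omega
      · have h2 : N[m].length ≤ N[i].length := List.pairwise_iff_getElem.1 hsorted m i hm hi hlt
        omega
    · have h1 := (hrule N[m] ((hN _).1 (List.getElem_mem hm))).2.1
      rw [hmj, hj] at h1
      simp only [List.getElem_map, hmj]
      injection h1 with h1
      injection h1 with h1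
      exact h1.symm
  · have hroot : [] ∈ N := (hN []).2 ⟨L, ht.root⟩
    refine ⟨rule [], List.mem_map_of_mem hroot, ?_⟩
    have h1 := (hrule [] ((hN _).1 hroot)).2.1
    rw [ht.root] at h1
    injection h1 with h1
    injection h1 with h1
    exact h1.symm
  · intro r hr L' hL'
    obtain ⟨p, hp, rfl⟩ := List.mem_map.1 hr
    obtain ⟨i, hi⟩ := hchild p hp _ hL'
    exact ⟨_, hi, ht.default_leaf _ _ hi⟩

/-- A node labelled with an objective literal has a rule or is a leaf without rules. -/
theorem IsTreeFor.exists_rule_or_leaf {k : TreeKind} {l : Literal α} {t : LTree α}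
    (ht : IsTreeFor P k l t) {p : List ℕ} {L : ObjLit α} (hp : t p = some (.obj L)) :
    (∃ r ∈ P, r.head = L) ∨ ((∀ r ∈ P, r.head ≠ L) ∧ t.IsLeaf p (.obj L)) := by
  rcases ht.objective_node p L hp with ⟨h, hleaf⟩ | ⟨r, hr, hrL, -⟩
  · exact .inr ⟨h, hp, hleaf⟩
  · exact .inl ⟨r, hr, hrL⟩

/-- A finite fully expanded tree for `L` yields a minimal argument for `L` whose assumptions label
leaves of the tree. -/
theorem IsTreeFor.exists_args {k : TreeKind} {L : ObjLit α} {t : LTree α}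
    (ht : IsTreeFor P k (.obj L) t) (hfin : t.IsFinite)
    (hexp : ∀ p L', t p = some (.obj L') → ∃ r ∈ P, r.head = L') :
    ∃ A : Args P, L ∈ conc A.1 ∧
      ∀ r ∈ A.1, ∀ L', .dflt L' ∈ successors k r → ∃ p, t.IsLeaf p (.dflt L') := by
  obtain ⟨A, hA, hL, hleaf⟩ := ht.exists_argument hfin hexp
  obtain ⟨B, hsub, hB⟩ := hA.exists_minimal hL
  exact ⟨⟨B, L, hB⟩, hB.2.1, fun r hr => hleaf r (hsub.subset hr)⟩

theorem Args.isArgument (A : Args P) : IsArgument P A.1 := by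
  obtain ⟨_, hA, _⟩ := A.2
  exact hA

theorem exists_rule_of_mem_treeLabels {k : TreeKind} {A : List (Rule α)} (hA : IsArgument P A)
    {L : ObjLit α} (hL : .obj L ∈ treeLabels k A) : ∃ r ∈ P, r.head = L := by
  rcases hL with ⟨L', ⟨r, hr, rfl⟩, h⟩ | ⟨r, hr, L', h, -⟩ <;> cases h
  exact ⟨r, hA.1 r hr, rfl⟩

theorem mem_assm_of_mem_treeLabels {A : List (Rule α)} {L : ObjLit α}
    (hL : .dflt L ∈ treeLabels .T A) : .dflt L ∈ assm A := by
  rcases hL with ⟨L', -, h⟩ | ⟨r, hr, L', h, hs⟩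
  · cases h
  · rcases mem_successors.1 hs with ⟨M, -, e⟩ | ⟨M, hM, e⟩ | ⟨e, -⟩
    · cases e
    · exact ⟨r, hr, M, hM, e⟩
    · cases e

/-- An argument concluding `L` attacks every argument with `not L` in a TU-tree built from it. -/
theorem attacks_of_mem_treeLabels {A B : Args P} {L : ObjLit α} (hA : L ∈ conc A.1)
    (hL : .dflt L ∈ treeLabels .TU B.1) : attacks P A B := by
  rcases hL with ⟨L', -, h⟩ | ⟨r, hr, L', h, hs⟩
  · cases h
  · rcases mem_successors.1 hs with ⟨M, -, e⟩ | ⟨M, hM, e⟩ | ⟨-, e⟩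
    · cases e
    · exact .inl ⟨L, hA, r, hr, M, hM, e⟩
    · injection e with e
      exact .inr ⟨L, hA, r, hr, by rw [e, ObjLit.compl_compl]⟩

/-- An undercut hits a default literal in a rule body; a rebuttal of a rule head `¬L` hits the
literal `not L` that TU-trees add for that head. -/
theorem exists_successor_of_attacks {A B : Args P} (h : attacks P A B) :
    ∃ L ∈ conc A.1, ∃ r ∈ B.1, .dflt L ∈ successors .TU r := by
  rcases h with ⟨L, hL, r, hr, M, hM, e⟩ | ⟨L, hL, r, hr, e⟩
  · exact ⟨L, hL, r, hr, mem_successors.2 (.inr (.inl ⟨M, hM, e⟩))⟩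
  · exact ⟨L, hL, r, hr, mem_successors.2 (.inr (.inr ⟨rfl, by rw [e, ObjLit.compl_compl]⟩))⟩

-- Justified arguments give successful T-trees

theorem exists_successful_of_provablyJustified {A : Args P}
    (hA : ProvablyJustified (undercuts P) (attacks P) A) : ∀ L ∈ conc A.1,
      ∃ t, IsTreeFor P .T (.obj L) t ∧ DeterminedSuccessful P .T t := by
  refine hA.induction (Q := fun A => ∀ L ∈ conc A.1,
      ∃ t, IsTreeFor P .T (.obj L) t ∧ DeterminedSuccessful P .T t) fun A ih L hL => ?_
  obtain ⟨t, ht, hfin, hlab⟩ := A.isArgument.exists_tree .T (.inl ⟨L, hL, rfl⟩)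
  refine ⟨t, ht, .intro _ _ hfin ?_⟩
  rintro p (L' | L') hp
  · exact .fact _ _ (exists_rule_of_mem_treeLabels A.isArgument (hlab p _ hp.1))
  · refine .allFailed _ _ fun t' ht' => ?_
    by_cases hfin' : t'.IsFinite
    swap
    · exact .infinite _ _ hfin'
    by_cases hexp : ∀ p L', t' p = some (.obj L') → ∃ r ∈ P, r.head = L'
    -- The TU-tree yields an undercutter `B` of `A`. The attacker `C` of `B` concludes some `M` with
    -- `not M` a leaf of the TU-tree, and induction makes that leaf fail. Since `M` can be any
    -- conclusion of `C`, the claim covers all conclusions.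
    · obtain ⟨B, hB, hBleaf⟩ := ht'.exists_args hfin' hexp
      obtain ⟨C, hCB, hC⟩ := ih B ⟨L', hB, mem_assm_of_mem_treeLabels (hlab p _ hp.1)⟩
      obtain ⟨M, hMC, r, hr, hMr⟩ := exists_successor_of_attacks hCB
      obtain ⟨q, hq⟩ := hBleaf r hr M hMr
      obtain ⟨s, hs, hsuc⟩ := hC M hMC
      exact .leaf _ _ q _ hq (.someSuccessful _ _ s hs hsuc)
    · push Not at hexp
      obtain ⟨q, M, hq, hM⟩ := hexp
      rcases ht'.exists_rule_or_leaf hq with ⟨r, hr, hrM⟩ | ⟨h, hleaf⟩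
      · exact absurd hrM (hM r hr)
      · exact .leaf _ _ q _ hleaf (.noRule _ _ h)

-- Successful T-trees give winning arguments

/-- `L` is a conclusion of an argument that is winning in the `u/a`-dialogue game. -/
def WinningConclusion (P : Program α) (L : ObjLit α) : Prop :=
  ∃ A : Args P, L ∈ conc A.1 ∧ Winning (undercuts P) (attacks P) (Player.proponent, A)

/-- A leaf of a TU-tree that is failed because of winning arguments. -/
def RefutedLeaf (P : Program α) : Literal α → Prop
  | .obj L => ∀ r ∈ P, r.head ≠ L
  | .dflt L => WinningConclusion P L

/-- A TU-tree that is failed because of winning arguments. -/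
def RefutedTree (P : Program α) (t : LTree α) : Prop :=
  t.IsFinite → ∃ p l, t.IsLeaf p l ∧ RefutedLeaf P l

/-- A leaf of a T-tree that is successful because of winning arguments. -/
def SupportedLeaf (P : Program α) : Literal α → Prop
  | .obj L => ∃ r ∈ P, r.head = L
  | .dflt L => ∀ t, IsTreeFor P .TU (.obj L) t → RefutedTree P t

theorem winningConclusion_of_supported {L : ObjLit α} {t : LTree α}
    (ht : IsTreeFor P .T (.obj L) t) (hfin : t.IsFinite)
    (hleaf : ∀ p l, t.IsLeaf p l → SupportedLeaf P l) : WinningConclusion P L := by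
  obtain ⟨A, hA, hAleaf⟩ := ht.exists_args hfin fun p L' hp =>
    (ht.exists_rule_or_leaf hp).elim id fun h => hleaf p _ h.2
  refine ⟨A, hA, winning_of_forall_exists fun B hBA => ?_⟩
  obtain ⟨L', hLB, r, hr, M, hM, e⟩ := hBA
  obtain ⟨p, hp⟩ := hAleaf r hr L' (mem_successors.2 (.inr (.inl ⟨M, hM, e⟩)))
  -- The tree built from the undercutter `B` itself is finite and has a rule for each objective
  -- label. It can only be refuted at a default leaf, and the winning argument found there attacks
  -- `B`.
  obtain ⟨s, hs, hsfin, hslab⟩ := B.isArgument.exists_tree .TU (.inl ⟨L', hLB, rfl⟩)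
  obtain ⟨q, l, hq, hl⟩ := hleaf p _ hp s hs hsfin
  have hlab := hslab q l hq.1
  rcases l with K | K
  · obtain ⟨r, hr, hrK⟩ := exists_rule_of_mem_treeLabels B.isArgument hlab
    exact absurd hrK (hl r hr)
  · obtain ⟨C, hC, hw⟩ := hl
    exact ⟨C, attacks_of_mem_treeLabels hC hlab, hw⟩

/-- Simultaneous induction over the four status predicates. Only success for kind `T` and failure
for kind `TU` feed into each other, so the motives are vacuous for the other kinds. -/
theorem winningConclusion_of_determinedSuccessful {L : ObjLit α} {t : LTree α}
    (ht : IsTreeFor P .T (.obj L) t) (hs : DeterminedSuccessful P .T t) :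
    WinningConclusion P L := by
  refine DeterminedSuccessful.rec (P := P)
    (motive_1 := fun k t _ => k = .T → ∀ L, IsTreeFor P .T (.obj L) t → WinningConclusion P L)
    (motive_2 := fun k t _ => k = .TU → RefutedTree P t)
    (motive_3 := fun k l _ => k = .T → SupportedLeaf P l)
    (motive_4 := fun k l _ => k = .TU → RefutedLeaf P l)
    ?_ ?_ ?_ ?_ ?_ ?_ ?_ hs rfl L ht
  · intro k t hfin _ ih hk L ht
    exact winningConclusion_of_supported ht hfin fun p l hp => ih p l hp hk
  · intro k t hinf _ hfin
    exact absurd hfin hinf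
  · intro k t p l hl _ ih hk _
    exact ⟨p, l, hl, ih hk⟩
  · intro k L h _
    exact h
  · rintro k L _ ih rfl t ht
    exact ih t ht rfl
  · intro k L h _
    exact h
  · rintro k L t ht _ ih rfl
    exact ih rfl L ht

end Trees

end ELP

theorem mainTheorem12 {α : Type*} (P : ELP.Program α) (L : ELP.ObjLit α) :
    ELP.ProvablyJustifiedConclusion (ELP.undercuts P) (ELP.attacks P) L ↔
      ∃ t : ELP.LTree α, ELP.IsTreeFor P ELP.TreeKind.T (ELP.Literal.obj L) t ∧
        ELP.IsSuccessful P ELP.TreeKind.T t := by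
  constructor
  · rintro ⟨A, hL, hA⟩
    exact ELP.exists_successful_of_provablyJustified hA L hL
  · rintro ⟨t, ht, hs⟩
    obtain ⟨A, hL, hA⟩ := ELP.winningConclusion_of_determinedSuccessful ht hs
    exact ⟨A, hL, hA.provablyJustified⟩
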